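/- Let $\Sigma$ be an alphabet with exactly three letters, and let $k\ge 2$. For words $u,v\in\Sigma^*$ write $u\preceq v$ if $u$ is a scattered factor (subsequence) of $v$, and write $u\sim_j v$ if $u$ and $v$ have the same scattered factors of length at most $j$ (for $j\le 0$ this always holds). Let $\mathrm{alph}(u)$ be the set of letters of $u$. For $\Omega\subseteq\Sigma$ nonempty, $\iota_\Omega(u)$ is the largest $m$ such that every word of length $m$ over $\Omega$ is a scattered factor of $u$. The arch factorization of $u\in\Omega^*$ with respect to $\Omega$ is $u=\mathrm{ar}_1(u)\cdots\mathrm{ar}_m(u)\,\mathrm{re}(u)$, where each arch $\mathrm{ar}_i(u)$ contains all letters of $\Omega$, the last letter of each arch occurs in it exactly once, and the rest $\mathrm{re}(u)$ does not contain all letters of $\Omega$; the modus $\mathrm m(u)$ is the word of the last letters of the arches. Applied to the reversal $u^R$ and reversed back, this gives the reverse arches, the reverse rest $\overline{\mathrm{re}}(u)=(\mathrm{re}(u^R))^R$ and the reverse modus $\overline{\mathrm m}(u)=(\mathrm m(u^R))^R$. A word $w\in\Sigma^*$ with $\iota_\Sigma(w)=1$ has the unique factorization $w=\alpha_0\beta\alpha_1$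 in which $\alpha_0\beta$ is the arch, $\alpha_1$ the rest, $\beta\alpha_1$ the reverse arch and $\alpha_0$ the reverse rest of $w$ with respect to $\Sigma$. Let $\mathrm{core}$ be $\beta$ without its first and last letter (empty if $|\beta|\le 2$). Since $|\mathrm{alph}(\alpha_i)|\le 2$, choose $\Omega_i\subseteq\Sigma$ with $|\Omega_i|=2$ and $\mathrm{alph}(\alpha_i)\subseteq\Omega_i$, and let $\iota(\alpha_i)$, $\mathrm{re}(\alpha_0)$, $\overline{\mathrm{re}}(\alpha_1)$ be taken with respect to $\Omega_i$ (they do not depend on the choice). **Theorem.** Let $w,\tilde w\in\Sigma^*$ with $\iota_\Sigma(w)=\iota_\Sigma(\tilde w)=1$, with factorizations $w=\alpha_0\beta\alpha_1$ and $\tilde w=\tilde\alpha_0\tilde\beta\tilde\alpha_1$. Then $w\sim_k\tilde w$ if and only if $\alpha_i\sim_{k-1}\tilde\alpha_i$ for $i=0,1$ and at least one of the following holds: 1. for some $i\in\{0,1\}$: $|\mathrm{alph}(\alpha_i)|=2$, $\mathrm{alph}(\alpha_{1-i})\cap\mathrm{alph}(\alpha_i)=\emptyset$ and $\iota(\alpha_i)\ge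 k-1$; 2. $\mathrm m(w)=\mathrm m(\tilde w)$, $\overline{\mathrm m}(w)=\overline{\mathrm m}(\tilde w)$, and $\mathrm{core}\sim_{k-c}\widetilde{\mathrm{core}}$, where $$c=\iota(\alpha_0)+\delta_{y\preceq\mathrm{re}(\alpha_0)}+\iota(\alpha_1)+\delta_{y\preceq\overline{\mathrm{re}}(\alpha_1)},$$ $y$ is the letter of $\Sigma$ different from $\mathrm m(w)$ and $\overline{\mathrm m}(w)$, and $\delta_P$ is $1$ if $P$ holds and $0$ otherwise. (Both cores are powers of $y$; if $\mathrm m(w)=\overline{\mathrm m}(w)$, both cores are empty and the condition on them is void.) -/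

import Mathlib

/-! Words over an alphabet `σ` are lists; `u` is a scattered factor of `w` iff `u.Sublist w`;
the set of letters of `w` is `w.toFinset`. -/

namespace Simon

variable {σ : Type*}

/-- The scattered factors of `w` of length at most `k`. -/
def scatFactLE (k : ℕ) (w : List σ) : Set (List σ) :=
  {v | v.Sublist w ∧ v.length ≤ k}

/-- Simon's congruence of level `k`. -/
def Congr (k : ℕ) (u v : List σ) : Prop :=
  scatFactLE k u = scatFactLE k v

/-- `w` is `k`-universal with respect to `Ω`: every word of length `k` over `Ω` is a scattered
factor of `w`. -/
def IsUniversal (Ω : Finset σ) (k : ℕ) (w : List σ) : Prop :=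
  ∀ v : List σ, v.length = k → (∀ a ∈ v, a ∈ Ω) → v.Sublist w

/-- The universality index with respect to `Ω`: the largest `k` such that `w` is `k`-universal
(for `Ω` nonempty such `k` are bounded by the length of `w`, and `0` is always one of them). -/
noncomputable def univIndex (Ω : Finset σ) (w : List σ) : ℕ :=
  sSup {k | IsUniversal Ω k w}

variable [DecidableEq σ]

/-- Greedy reading from left to right: `cur` is the part of the current arch read so far, and the
arch is closed as soon as it contains every letter of `Ω`. Returns the arches and the rest. -/
def archAux (Ω : Finset σ) : List σ → List σ → List (List σ) × List σ
  | cur, [] => ([], cur)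
  | cur, a :: w =>
    if Ω ⊆ (cur ++ [a]).toFinset then
      ((cur ++ [a]) :: (archAux Ω [] w).1, (archAux Ω [] w).2)
    else archAux Ω (cur ++ [a]) w

/-- The arches of `w` with respect to `Ω`. -/
def arches (Ω : Finset σ) (w : List σ) : List (List σ) := (archAux Ω [] w).1

/-- The rest `re(w)` of the arch factorization with respect to `Ω`. -/
def rest (Ω : Finset σ) (w : List σ) : List σ := (archAux Ω [] w).2

/-- The modus `m(w)`: the word of the last letters of the arches. -/
def modus (Ω : Finset σ) (w : List σ) : List σ := (arches Ω w).filterMap List.getLast?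

/-- The reverse arches, listed from left to right. -/
def revArches (Ω : Finset σ) (w : List σ) : List (List σ) :=
  ((arches Ω w.reverse).map List.reverse).reverse

/-- The reverse rest. -/
def revRest (Ω : Finset σ) (w : List σ) : List σ := (rest Ω w.reverse).reverse

/-- The reverse modus. -/
def revModus (Ω : Finset σ) (w : List σ) : List σ := (modus Ω w.reverse).reverse

theorem archAux_spec (Ω : Finset σ) (w : List σ) : ∀ cur : List σ, ¬ Ω ⊆ cur.toFinset →
    (archAux Ω cur w).1.flatten ++ (archAux Ω cur w).2 = cur ++ w ∧
    (∀ A ∈ (archAux Ω cur w).1, Ω ⊆ A.toFinset ∧ ¬ Ω ⊆ A.dropLast.toFinset) ∧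
    ¬ Ω ⊆ (archAux Ω cur w).2.toFinset := by
  induction w with
  | nil => intro cur h; simpa [archAux] using h
  | cons a w ih =>
    intro cur h
    have h0 : ¬ Ω ⊆ ([] : List σ).toFinset := fun h' => h (h'.trans (by simp))
    unfold archAux
    split_ifs with hc
    · obtain ⟨h1, h2, h3⟩ := ih [] h0
      refine ⟨?_, ?_, h3⟩
      · simp only [List.flatten_cons, List.append_assoc, h1]
        simp
      · intro A hA
        rcases List.mem_cons.1 hA with rfl | hA
        · exact ⟨hc, by simpa using h⟩
        · exact h2 A hA
    · obtain ⟨h1, h2, h3⟩ := ih (cur ++ [a]) hc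
      exact ⟨by simpa using h1, h2, h3⟩

/-- Over a nonempty alphabet the arches are shortest factors containing all of `Ω`, the rest misses
a letter of `Ω`, and together they factorize `w`. -/
theorem arches_spec (Ω : Finset σ) (hΩ : Ω.Nonempty) (w : List σ) :
    (arches Ω w).flatten ++ rest Ω w = w ∧
    (∀ A ∈ arches Ω w, Ω ⊆ A.toFinset ∧ ¬ Ω ⊆ A.dropLast.toFinset) ∧
    ¬ Ω ⊆ (rest Ω w).toFinset := by
  have h := archAux_spec Ω w [] (by simpa [Finset.subset_empty] using hΩ.ne_empty)
  simpa [arches, rest] using h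

variable [Fintype σ]

mutual

/-- The factor `α_i` of the `α`-`β`-factorization with respect to the whole alphabet:
`α_0` is the reverse rest, and `β_i α_i` is the `i`-th reverse arch. -/
def alpha (w : List σ) : ℕ → List σ
  | 0 => revRest Finset.univ w
  | i + 1 => ((revArches Finset.univ w).getD i []).drop (beta w (i + 1)).length

/-- The factor `β_i` (for `i ≥ 1`): `α_{i-1} β_i` is the `i`-th arch. -/
def beta (w : List σ) : ℕ → List σ
  | 0 => []
  | i + 1 => ((arches Finset.univ w).getD i []).drop (alpha w i).length

end

/-- `core_i`: the factor `β_i` without its first and last letter (empty if `β_i` has length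
at most two). -/
def core (w : List σ) (i : ℕ) : List σ := (beta w i).tail.dropLast

end Simon

/-! Write `w = α₀βα₁`, where `β` starts with `a` and ends with `b`. Since `a` occurs in `βα₁` only
as its first letter, `ua` is a scattered factor of `w` iff `u` is one of `α₀`. Hence the
`∼ₖ`-class of `w` determines the `∼ₖ₋₁`-class of `α₀` and, by reversal, that of `α₁`.

Suppose that `w` and `w'` are congruent but differ in this letter, `a ≠ a'`. If `u` is a scattered
factor of `α₀` of length less than `k - 1`, then `uaa'` is one of `w` and hence of `w'`, so `ua` is
one of `α₀'` and thus of `α₀`; by symmetry so is `ua'`. So `α₀` contains all words of length `k - 1`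
over `{a, a'}`, the third letter `b` does not occur in it, and `α₁` is a power of `b`. For such
words everything in front of the first `b` is absorbed by `α₀`, and only the classes of `α₀` and
`α₁` matter.

If the words agree in `a` and `b`, their outer factors can be exchanged, and it remains to compare
`x yᵐ z` with `x yⁿ z` for `x = α₀a` and `z = bα₁`. In a scattered factor `u yʲ v` superfluous `y`s
can be moved into `x` and `z` until `u` and `v` have the length of a shortest word whose embedding
leaves no `y`. These lengths are given by the arch factorization, as the modus of `x` is such a
word for `x`. -/

namespace Simon

open scoped List

variable {σ : Type*}

theorem cons_sublist_append_cons_iff {a : σ} {u v w : List σ} (ha : a ∉ w) :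
    a :: u <+ w ++ a :: v ↔ u <+ v := by
  induction w with
  | nil => simp
  | cons d w ih =>
    obtain ⟨had, haw⟩ := List.ne_and_not_mem_of_not_mem_cons ha
    rw [← ih haw]
    exact ⟨List.Sublist.of_cons_of_ne had, .cons d⟩

theorem append_singleton_sublist_append_cons_iff {a : σ} {u v w : List σ} (ha : a ∉ v) :
    u ++ [a] <+ w ++ a :: v ↔ u <+ w := by
  rw [← List.reverse_sublist, ← List.reverse_sublist (l₁ := u)]
  simpa using cons_sublist_append_cons_iff (u := u.reverse) (v := w.reverse)
    (List.mem_reverse.not.2 ha)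

theorem cons_sublist_of_append_cons_sublist_append {y : σ} {u s v w : List σ}
    (hu : ¬ u ++ [y] <+ v) (h : u ++ y :: s <+ v ++ w) : y :: s <+ w := by
  obtain ⟨p, r, hpr, hp, hr⟩ := List.sublist_append_iff.1 h
  rcases List.append_eq_append_iff.1 hpr with ⟨_ | ⟨c, t⟩, hpt, hrt⟩ | ⟨t, -, hrt⟩
  · exact hrt ▸ hr
  · obtain ⟨rfl, -⟩ := List.cons_eq_cons.1 hrt
    refine absurd (List.Sublist.trans ?_ hp) hu
    simp [hpt]
  · exact (List.sublist_append_right t _).trans (hrt ▸ hr)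

theorem append_replicate_append_sublist_iff {y : σ} {u v x z : List σ} {j n : ℕ}
    (hu : u <+ x) (hv : v <+ z) (huy : ¬ u ++ [y] <+ x) (hvy : ¬ y :: v <+ z) :
    u ++ List.replicate j y ++ v <+ x ++ List.replicate n y ++ z ↔ j ≤ n := by
  refine ⟨fun h => ?_, fun h => (hu.append ((List.replicate_sublist_replicate y).2 h)).append hv⟩
  rcases j with _ | j
  · exact n.zero_le
  have hright : List.replicate (j + 1) y ++ v <+ List.replicate n y ++ z := by
    simp only [List.append_assoc, List.replicate_succ, List.cons_append] at h ⊢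
    exact cons_sublist_of_append_cons_sublist_append huy h
  have hleft : List.replicate (j + 1) y <+ List.replicate n y := by
    rw [← List.reverse_sublist] at hright hvy ⊢
    simp only [List.reverse_append, List.reverse_cons, List.reverse_replicate] at hright hvy ⊢
    rw [List.replicate_succ] at hright ⊢
    exact cons_sublist_of_append_cons_sublist_append hvy hright
  simpa using hleft.length_le

section Congr

variable {k : ℕ} {u v x : List σ}

theorem congr_iff : Congr k u v ↔ ∀ x : List σ, x.length ≤ k → (x <+ u ↔ x <+ v) := by
  simp only [Congr, scatFactLE, Set.ext_iff, Set.mem_ofPred_eq, and_congr_left_iff]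

theorem Congr.sublist_iff (h : Congr k u v) (hx : x.length ≤ k) : x <+ u ↔ x <+ v :=
  congr_iff.1 h x hx

theorem Congr.symm (h : Congr k u v) : Congr k v u := Eq.symm h

theorem Congr.trans (h : Congr k u v) (h' : Congr k v x) : Congr k u x := Eq.trans h h'

theorem congr_of_sublist (h : ∀ x : List σ, x.length ≤ k → x <+ u → x <+ v)
    (h' : ∀ x : List σ, x.length ≤ k → x <+ v → x <+ u) : Congr k u v :=
  congr_iff.2 fun x hx => ⟨h x hx, h' x hx⟩

theorem Congr.mem_iff (h : Congr k u v) (hk : 1 ≤ k) (a : σ) : a ∈ u ↔ a ∈ v := by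
  simpa using h.sublist_iff (x := [a]) hk

theorem Congr.toFinset_eq [DecidableEq σ] (h : Congr k u v) (hk : 1 ≤ k) :
    u.toFinset = v.toFinset := by
  ext a
  simpa using h.mem_iff hk a

theorem Congr.reverse (h : Congr k u v) : Congr k u.reverse v.reverse :=
  congr_iff.2 fun x hx => by
    simpa only [List.sublist_reverse_iff] using h.sublist_iff (x.length_reverse.trans_le hx)

theorem congr_reverse_iff : Congr k u.reverse v.reverse ↔ Congr k u v :=
  ⟨fun h => by simpa using h.reverse, Congr.reverse⟩

theorem Congr.append_right (h : Congr k u v) (hx : ∀ c, c ∈ x) :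
    Congr (k + 1) (u ++ x) (v ++ x) := by
  suffices key : ∀ {u v : List σ}, Congr k u v → ∀ s : List σ, s.length ≤ k + 1 →
      s <+ u ++ x → s <+ v ++ x from congr_of_sublist (key h) (key h.symm)
  intro u v h s hs hsu
  obtain ⟨p, r, rfl, hp, hr⟩ := List.sublist_append_iff.1 hsu
  rw [List.length_append] at hs
  rcases List.eq_nil_or_concat' r with rfl | ⟨r, d, rfl⟩
  · rcases List.eq_nil_or_concat' p with rfl | ⟨p, c, rfl⟩
    · exact List.nil_sublist _
    · rw [List.append_nil]
      exact ((h.sublist_iff (by simpa using hs)).1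
        ((List.sublist_append_left _ _).trans hp)).append (List.singleton_sublist.2 (hx c))
  · rw [List.length_append, List.length_singleton] at hs
    exact ((h.sublist_iff (by lia)).1 hp).append hr

theorem Congr.append_left (h : Congr k u v) (hx : ∀ c, c ∈ x) :
    Congr (k + 1) (x ++ u) (x ++ v) := by
  rw [← congr_reverse_iff, List.reverse_append, List.reverse_append]
  exact h.reverse.append_right fun c => List.mem_reverse.2 (hx c)

theorem congr_replicate_iff {y : σ} {m n : ℕ} :
    Congr k (List.replicate m y) (List.replicate n y) ↔ ∀ j ≤ k, (j ≤ m ↔ j ≤ n) := by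
  rw [congr_iff]
  refine ⟨fun h j hj => ?_, fun h x hx => ?_⟩
  · simpa only [List.replicate_sublist_replicate] using
      h (List.replicate j y) (List.length_replicate.trans_le hj)
  · simp only [List.sublist_replicate_iff]
    refine exists_congr fun j => and_congr_left ?_
    rintro rfl
    exact h j (List.length_replicate.ge.trans hx)

end Congr

section Absorption

variable {y : σ} {u w x z : List σ} {k m n : ℕ}

/-- The absorption length of `y` in `w`: the length of a shortest scattered factor `u` of `w` for
which `uy` is no scattered factor of `w`. It is never the infimum of an empty set, since `u = w`
qualifies. -/
noncomputable def absorption (y : σ) (w : List σ) : ℕ :=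
  sInf {n | ∃ u : List σ, u <+ w ∧ u.length = n ∧ ¬ u ++ [y] <+ w}

theorem exists_length_eq_absorption (y : σ) (w : List σ) :
    ∃ u : List σ, u <+ w ∧ u.length = absorption y w ∧ ¬ u ++ [y] <+ w := by
  have hne : {n | ∃ u : List σ, u <+ w ∧ u.length = n ∧ ¬ u ++ [y] <+ w}.Nonempty :=
    ⟨w.length, w, .refl w, rfl, fun h => by simpa using h.length_le⟩
  exact Nat.sInf_mem hne

theorem absorption_le (hu : u <+ w) (huy : ¬ u ++ [y] <+ w) : absorption y w ≤ u.length :=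
  Nat.sInf_le ⟨u, hu, rfl, huy⟩

theorem append_singleton_sublist_of_length_lt_absorption (hu : u <+ w)
    (hl : u.length < absorption y w) : u ++ [y] <+ w :=
  not_imp_comm.1 (absorption_le hu) hl.not_ge

theorem cons_sublist_of_length_lt_absorption_reverse (hu : u <+ w)
    (hl : u.length < absorption y w.reverse) : y :: u <+ w := by
  simpa using (append_singleton_sublist_of_length_lt_absorption hu.reverse
    (u.length_reverse.trans_lt hl)).reverse

theorem congr_append_replicate_succ_append
    (hn : k ≤ n + (absorption y x + absorption y z.reverse)) :
    Congr k (x ++ List.replicate (n + 1) y ++ z) (x ++ List.replicate n y ++ z) := by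
  refine congr_of_sublist (fun s hs hsub => ?_) fun s _ hsub => hsub.trans
    (((List.Sublist.refl x).append ((List.replicate_sublist_replicate y).2 n.le_succ)).append
      (.refl z))
  obtain ⟨q, r, rfl, hq, hr⟩ := List.sublist_append_iff.1 hsub
  obtain ⟨p, m, rfl, hp, hm⟩ := List.sublist_append_iff.1 hq
  obtain ⟨j, hj, rfl⟩ := List.sublist_replicate_iff.1 hm
  have hmid {i : ℕ} (hi : i ≤ n) := (List.replicate_sublist_replicate y).2 hi
  rcases hj.lt_or_eq with hj | rfl
  · exact (hp.append (hmid (Nat.lt_succ_iff.1 hj))).append hr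
  simp only [List.length_append, List.length_replicate] at hs
  by_cases hpl : p.length < absorption y x
  · have := (append_singleton_sublist_of_length_lt_absorption hp hpl).append (hmid le_rfl)
    simpa [List.replicate_succ] using this.append hr
  · have := cons_sublist_of_length_lt_absorption_reverse (y := y) hr (by lia)
    simpa [List.replicate_succ'] using (hp.append (hmid le_rfl)).append this

theorem congr_append_replicate_append_of_le (hmn : m ≤ n)
    (hm : k ≤ m + (absorption y x + absorption y z.reverse)) :
    Congr k (x ++ List.replicate n y ++ z) (x ++ List.replicate m y ++ z) := by
  induction n, hmn using Nat.le_induction with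
  | base => rfl
  | succ n hmn ih => exact (congr_append_replicate_succ_append (by lia)).trans ih

theorem congr_append_replicate_append_iff :
    Congr k (x ++ List.replicate m y ++ z) (x ++ List.replicate n y ++ z) ↔
      Congr (k - (absorption y x + absorption y z.reverse))
        (List.replicate m y) (List.replicate n y) := by
  rw [congr_replicate_iff]
  constructor
  · intro h j hj
    rcases j.eq_zero_or_pos with rfl | hj0
    · simp only [Nat.zero_le]
    obtain ⟨u, hu, hul, huy⟩ := exists_length_eq_absorption y x
    obtain ⟨v, hv, hvl, hvy⟩ := exists_length_eq_absorption y z.reverse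
    have hvy' : ¬ y :: v.reverse <+ z := fun hs => hvy (by simpa using hs.reverse)
    have hiff := h.sublist_iff (x := u ++ List.replicate j y ++ v.reverse)
      (by simp only [List.length_append, List.length_replicate, List.length_reverse]; lia)
    rw [List.sublist_reverse_iff] at hv
    rwa [append_replicate_append_sublist_iff hu hv huy hvy',
      append_replicate_append_sublist_iff hu hv huy hvy'] at hiff
  · intro h
    have hcases : m = n ∨ k ≤ min m n + (absorption y x + absorption y z.reverse) := by
      have := h (min m n + 1)
      lia
    rcases hcases with rfl | hk
    · rfl
    rcases le_total m n with hmn | hnm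
    · exact (congr_append_replicate_append_of_le hmn (by lia)).symm
    · exact congr_append_replicate_append_of_le hnm (by lia)

end Absorption

section Universal

variable {Ω : Finset σ} {m : ℕ} {v w : List σ}

theorem IsUniversal.sublist_of_length_le (h : IsUniversal Ω m w) (hΩ : Ω.Nonempty)
    (hl : v.length ≤ m) (hv : ∀ a ∈ v, a ∈ Ω) : v <+ w := by
  obtain ⟨d, hd⟩ := hΩ
  refine (List.sublist_append_left v (List.replicate (m - v.length) d)).trans (h _ ?_ ?_)
  · rw [List.length_append, List.length_replicate, Nat.add_sub_cancel' hl]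
  · exact List.forall_mem_append.2 ⟨hv, fun a ha => List.eq_of_mem_replicate ha ▸ hd⟩

theorem isUniversal_zero (Ω : Finset σ) (w : List σ) : IsUniversal Ω 0 w := fun v hv _ => by
  rw [List.eq_nil_of_length_eq_zero hv]
  exact List.nil_sublist w

theorem IsUniversal.le_length (h : IsUniversal Ω m w) (hΩ : Ω.Nonempty) : m ≤ w.length := by
  obtain ⟨d, hd⟩ := hΩ
  simpa using (h (List.replicate m d) List.length_replicate
    fun a ha => List.eq_of_mem_replicate ha ▸ hd).length_le

theorem le_univIndex_iff (hΩ : Ω.Nonempty) : m ≤ univIndex Ω w ↔ IsUniversal Ω m w := by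
  have hbdd : BddAbove {k | IsUniversal Ω k w} := ⟨w.length, fun _ hk => hk.le_length hΩ⟩
  have hmax : IsUniversal Ω (univIndex Ω w) w := Nat.sSup_mem ⟨0, isUniversal_zero Ω w⟩ hbdd
  exact ⟨fun h v hl hv => hmax.sublist_of_length_le hΩ (hl.trans_le h) hv,
    fun h => le_csSup hbdd h⟩

theorem IsUniversal.reverse (h : IsUniversal Ω m w) : IsUniversal Ω m w.reverse :=
  fun v hl hv => List.sublist_reverse_iff.2
    (h v.reverse (v.length_reverse.trans hl) fun a ha => hv a (List.mem_reverse.1 ha))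

theorem isUniversal_reverse : IsUniversal Ω m w.reverse ↔ IsUniversal Ω m w :=
  ⟨fun h => by simpa using h.reverse, IsUniversal.reverse⟩

theorem univIndex_reverse (Ω : Finset σ) (w : List σ) :
    univIndex Ω w.reverse = univIndex Ω w := by
  simp only [univIndex, isUniversal_reverse]

end Universal

section Arches

variable [DecidableEq σ] {Ω Ω' : Finset σ} {a y : σ} {s u v w x : List σ}

theorem mem_and_notMem_of_subset_toFinset_append_singleton
    (h : Ω ⊆ (u ++ [a]).toFinset) (h' : ¬ Ω ⊆ u.toFinset) : a ∈ Ω ∧ a ∉ u := by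
  obtain ⟨c, hc, hcu⟩ := Finset.not_subset.1 h'
  have hca : c = a := by simpa [List.mem_toFinset.not.1 hcu] using h hc
  exact hca ▸ ⟨hc, List.mem_toFinset.not.1 hcu⟩

theorem archAux_append_singleton (Ω : Finset σ) (a : σ) (w cur : List σ) :
    archAux Ω cur (w ++ [a]) =
      if Ω ⊆ ((archAux Ω cur w).2 ++ [a]).toFinset
      then ((archAux Ω cur w).1 ++ [(archAux Ω cur w).2 ++ [a]], [])
      else ((archAux Ω cur w).1, (archAux Ω cur w).2 ++ [a]) := by
  induction w generalizing cur with
  | nil => rfl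
  | cons c w ih =>
    simp only [List.cons_append, archAux, ih]
    split_ifs <;> rfl

theorem arches_append_singleton (Ω : Finset σ) (w : List σ) (a : σ) :
    arches Ω (w ++ [a]) =
      if Ω ⊆ (rest Ω w ++ [a]).toFinset then arches Ω w ++ [rest Ω w ++ [a]]
      else arches Ω w := by
  rw [arches, archAux_append_singleton, apply_ite Prod.fst]
  rfl

theorem rest_append_singleton (Ω : Finset σ) (w : List σ) (a : σ) :
    rest Ω (w ++ [a]) = if Ω ⊆ (rest Ω w ++ [a]).toFinset then [] else rest Ω w ++ [a] := by
  rw [rest, archAux_append_singleton, apply_ite Prod.snd]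
  rfl

theorem modus_append_singleton (Ω : Finset σ) (w : List σ) (a : σ) :
    modus Ω (w ++ [a]) =
      if Ω ⊆ (rest Ω w ++ [a]).toFinset then modus Ω w ++ [a] else modus Ω w := by
  rw [modus, arches_append_singleton]
  split_ifs
  · simp [modus]
  · rfl

theorem length_modus (Ω : Finset σ) (w : List σ) :
    (modus Ω w).length = (arches Ω w).length := by
  induction w using List.reverseRecOn with
  | nil => rfl
  | append_singleton w a ih =>
    rw [modus_append_singleton, arches_append_singleton]
    split_ifs <;> simp [ih]

theorem not_subset_rest (hΩ : Ω.Nonempty) (w : List σ) : ¬ Ω ⊆ (rest Ω w).toFinset :=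
  (arches_spec Ω hΩ w).2.2

theorem mem_of_mem_modus (hΩ : Ω.Nonempty) (ha : a ∈ modus Ω w) : a ∈ Ω := by
  induction w using List.reverseRecOn with
  | nil => exact absurd ha List.not_mem_nil
  | append_singleton w c ih =>
    rw [modus_append_singleton] at ha
    split_ifs at ha with hc
    · rcases List.mem_append.1 ha with ha | ha
      · exact ih ha
      · exact List.mem_singleton.1 ha ▸
          (mem_and_notMem_of_subset_toFinset_append_singleton hc (not_subset_rest hΩ w)).1
    · exact ih ha

theorem modus_append_sublist_append_iff (hΩ : Ω.Nonempty) :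
    modus Ω w ++ s <+ w ++ x ↔ s <+ rest Ω w ++ x := by
  induction w using List.reverseRecOn generalizing s x with
  | nil => rfl
  | append_singleton w c ih =>
    rw [modus_append_singleton, rest_append_singleton]
    split_ifs with hc
    · have hcr := (mem_and_notMem_of_subset_toFinset_append_singleton hc
        (not_subset_rest hΩ w)).2
      rw [List.append_assoc, List.append_assoc, ih]
      exact cons_sublist_append_cons_iff hcr
    · rw [List.append_assoc, List.append_assoc, ih]

theorem modus_append_singleton_sublist_iff (hΩ : Ω.Nonempty) :
    modus Ω w ++ [y] <+ w ↔ y ∈ rest Ω w := by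
  simpa using modus_append_sublist_append_iff hΩ (w := w) (s := [y]) (x := [])

theorem modus_sublist (hΩ : Ω.Nonempty) (w : List σ) : modus Ω w <+ w := by
  simpa using (modus_append_sublist_append_iff hΩ (x := [])).2 (List.nil_sublist (rest Ω w ++ []))

theorem sublist_flatten_of_length_le {L : List (List σ)} (hL : ∀ A ∈ L, Ω ⊆ A.toFinset)
    (hl : v.length ≤ L.length) (hv : ∀ a ∈ v, a ∈ Ω) : v <+ L.flatten := by
  induction L generalizing v with
  | nil => simpa using hl
  | cons A L ih =>
    rcases v with _ | ⟨a, v⟩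
    · exact List.nil_sublist _
    obtain ⟨ha, hv⟩ := List.forall_mem_cons.1 hv
    obtain ⟨hA, hL⟩ := List.forall_mem_cons.1 hL
    exact (List.singleton_sublist.2 (List.mem_toFinset.1 (hA ha))).append
      (ih hL (by simpa using hl) hv)

theorem isUniversal_length_arches (hΩ : Ω.Nonempty) (w : List σ) :
    IsUniversal Ω (arches Ω w).length w := by
  obtain ⟨hw, harch, -⟩ := arches_spec Ω hΩ w
  intro v hl hv
  have := sublist_flatten_of_length_le (fun A hA => (harch A hA).1) hl.le hv
  exact hw ▸ this.trans (List.sublist_append_left _ _)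

theorem univIndex_eq_length_arches (hΩ : Ω.Nonempty) (w : List σ) :
    univIndex Ω w = (arches Ω w).length := by
  refine le_antisymm ?_ ((le_univIndex_iff hΩ).2 (isUniversal_length_arches hΩ w))
  by_contra! hlt
  obtain ⟨d, hd, hdr⟩ := Finset.not_subset.1 (not_subset_rest hΩ w)
  have hsub : modus Ω w ++ [d] <+ w := (le_univIndex_iff hΩ).1 (Nat.succ_le_of_lt hlt) _
    (by simp [length_modus])
    (List.forall_mem_append.2 ⟨fun a => mem_of_mem_modus hΩ, by simpa using hd⟩)
  exact hdr (List.mem_toFinset.2 ((modus_append_singleton_sublist_iff hΩ).1 hsub))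

theorem absorption_eq_univIndex (hw : w.toFinset ⊆ Ω) (hy : y ∈ Ω) (hr : y ∉ rest Ω w) :
    absorption y w = univIndex Ω w := by
  have hΩ : Ω.Nonempty := ⟨y, hy⟩
  apply le_antisymm
  · rw [univIndex_eq_length_arches hΩ, ← length_modus]
    exact absorption_le (modus_sublist hΩ w) ((modus_append_singleton_sublist_iff hΩ).not.2 hr)
  · obtain ⟨u, hu, hul, huy⟩ := exists_length_eq_absorption y w
    by_contra! hlt
    refine huy (((le_univIndex_iff hΩ).1 le_rfl).sublist_of_length_le hΩ (by simp; lia) ?_)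
    exact List.forall_mem_append.2
      ⟨fun a ha => hw (List.mem_toFinset.2 (hu.subset ha)), by simpa using hy⟩

theorem absorption_append_singleton (hay : a ≠ y) (hw : w.toFinset ⊆ {a, y}) :
    absorption y (w ++ [a]) = univIndex {a, y} w + if y ∈ rest {a, y} w then 1 else 0 := by
  have hΩ : ({a, y} : Finset σ).Nonempty := Finset.insert_nonempty a {y}
  have hclose : {a, y} ⊆ (rest {a, y} w ++ [a]).toFinset ↔ y ∈ rest {a, y} w := by
    simp [Finset.insert_subset_iff, hay.symm]
  rw [absorption_eq_univIndex (Ω := {a, y}) (by simpa [Finset.insert_subset_iff] using hw)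
    (by simp)]
  · rw [univIndex_eq_length_arches hΩ, univIndex_eq_length_arches hΩ, arches_append_singleton]
    simp only [hclose]
    split_ifs <;> simp
  · rw [rest_append_singleton]
    simp only [hclose]
    split_ifs with hy <;> simp [hy, hay.symm]

theorem arches_eq_nil_of_not_subset (h : ¬ Ω ⊆ w.toFinset) : arches Ω w = [] := by
  have hΩ : Ω.Nonempty := (Finset.not_subset.1 h).imp fun _ => And.left
  obtain ⟨hw, harch, -⟩ := arches_spec Ω hΩ w
  refine List.eq_nil_iff_forall_not_mem.2 fun A hA => h ((harch A hA).1.trans ?_)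
  exact fun a ha => List.mem_toFinset.2 (hw ▸ List.mem_append_left _
    (List.mem_flatten_of_mem hA (List.mem_toFinset.1 ha)))

theorem rest_eq_self_of_not_subset (h : ¬ Ω ⊆ w.toFinset) : rest Ω w = w := by
  have hΩ : Ω.Nonempty := (Finset.not_subset.1 h).imp fun _ => And.left
  simpa [arches_eq_nil_of_not_subset h] using (arches_spec Ω hΩ w).1

theorem eq_or_not_subset_of_card_eq (hw : w.toFinset ⊆ Ω) (hw' : w.toFinset ⊆ Ω')
    (hcard : Ω.card = Ω'.card) : Ω = Ω' ∨ ¬ Ω ⊆ w.toFinset ∧ ¬ Ω' ⊆ w.toFinset := by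
  rw [or_iff_not_imp_left]
  exact fun hne =>
    ⟨fun h => hne (Finset.eq_of_subset_of_card_le (h.trans hw') hcard.ge),
      fun h => hne (Finset.eq_of_subset_of_card_le (h.trans hw) hcard.le).symm⟩

theorem univIndex_eq_of_card_eq (hΩ : Ω.Nonempty) (hw : w.toFinset ⊆ Ω)
    (hw' : w.toFinset ⊆ Ω') (hcard : Ω.card = Ω'.card) : univIndex Ω w = univIndex Ω' w := by
  have hΩ' : Ω'.Nonempty := Finset.card_pos.1 (hcard ▸ hΩ.card_pos)
  rw [univIndex_eq_length_arches hΩ, univIndex_eq_length_arches hΩ']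
  rcases eq_or_not_subset_of_card_eq hw hw' hcard with rfl | ⟨h, h'⟩
  · rfl
  · rw [arches_eq_nil_of_not_subset h, arches_eq_nil_of_not_subset h']

theorem rest_eq_of_card_eq (hw : w.toFinset ⊆ Ω) (hw' : w.toFinset ⊆ Ω')
    (hcard : Ω.card = Ω'.card) : rest Ω w = rest Ω' w := by
  rcases eq_or_not_subset_of_card_eq hw hw' hcard with rfl | ⟨h, h'⟩
  · rfl
  · rw [rest_eq_self_of_not_subset h, rest_eq_self_of_not_subset h']

theorem absorption_append_singleton_of_card_eq_two (hay : a ≠ y) (hw : w.toFinset ⊆ {a, y})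
    (hcard : Ω.card = 2) (hwΩ : w.toFinset ⊆ Ω) :
    absorption y (w ++ [a]) = univIndex Ω w + if y ∈ rest Ω w then 1 else 0 := by
  have hcard' : ({a, y} : Finset σ).card = Ω.card := by rw [Finset.card_pair hay, hcard]
  rw [absorption_append_singleton hay hw, rest_eq_of_card_eq hw hwΩ hcard',
    univIndex_eq_of_card_eq (Finset.insert_nonempty a {y}) hw hwΩ hcard']

theorem absorption_append_singleton_reverse_of_card_eq_two (hay : a ≠ y)
    (hw : w.toFinset ⊆ {a, y}) (hcard : Ω.card = 2) (hwΩ : w.toFinset ⊆ Ω) :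
    absorption y (a :: w).reverse = univIndex Ω w + if y ∈ revRest Ω w then 1 else 0 := by
  rw [List.reverse_cons, absorption_append_singleton_of_card_eq_two hay (Ω := Ω) (by simpa)
    hcard (by simpa), univIndex_reverse]
  simp only [revRest, List.mem_reverse]

end Arches

section AlphaBeta

variable {w α₀ β α₁ w' α₀' β' α₁' u v : List σ} {a b a' b' y : σ} {k : ℕ}

/-- The `α`-`β`-factorization `w = α₀βα₁` of a word with exactly one arch over the whole alphabet:
`α₀β` is the arch, with last letter `b`, and `βα₁` is the reverse arch, with first letter `a`. -/
structure IsAlphaBeta (w α₀ β α₁ : List σ) (a b : σ) : Prop where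
  eq : w = α₀ ++ β ++ α₁
  head : ∃ t, β = a :: t ∧ a ∉ t ∧ a ∉ α₁
  last : ∃ s, β = s ++ [b] ∧ b ∉ α₀ ∧ b ∉ s
  mem_arch : ∀ c, c ∈ α₀ ++ β
  mem_revArch : ∀ c, c ∈ β ++ α₁

/-- The first alternative of the theorem for the pair `(u, v)`: the word `u` has two letters, none
of them occurs in `v`, and all words of length `k` over them are scattered factors of `u`. -/
def IsSaturated [DecidableEq σ] (k : ℕ) (u v : List σ) : Prop :=
  u.toFinset.card = 2 ∧ v.toFinset ∩ u.toFinset = ∅ ∧ IsUniversal u.toFinset k u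

theorem isSaturated_reverse [DecidableEq σ] :
    IsSaturated k u.reverse v.reverse ↔ IsSaturated k u v := by
  simp only [IsSaturated, List.toFinset_reverse, isUniversal_reverse]

theorem IsSaturated.congr [DecidableEq σ] (h : IsSaturated k α₀ α₁) (h₀ : Congr k α₀ α₀')
    (h₁ : Congr k α₁ α₁') (hk : 1 ≤ k) : IsSaturated k α₀' α₁' := by
  rw [IsSaturated, h₀.toFinset_eq hk, h₁.toFinset_eq hk] at h
  exact ⟨h.1, h.2.1, fun v hl hv => (h₀.sublist_iff hl.le).1 (h.2.2 v hl hv)⟩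

theorem eq_or_eq_or_eq_of_card_le_three [Fintype σ] (hσ : Fintype.card σ ≤ 3) {x y z : σ}
    (hxy : x ≠ y) (hxz : x ≠ z) (hyz : y ≠ z) (c : σ) : c = x ∨ c = y ∨ c = z := by
  by_contra! h
  have hnodup : [c, x, y, z].Nodup := by simp [h, hxy, hxz, hyz]
  exact absurd (hnodup.length_le_card.trans hσ) (by simp)

namespace IsAlphaBeta

theorem reverse (h : IsAlphaBeta w α₀ β α₁ a b) :
    IsAlphaBeta w.reverse α₁.reverse β.reverse α₀.reverse b a where
  eq := by simp [h.eq]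
  head := by
    obtain ⟨s, hs, hb₀, hbs⟩ := h.last
    exact ⟨s.reverse, by simp [hs], by simpa, by simpa⟩
  last := by
    obtain ⟨t, ht, hat, ha₁⟩ := h.head
    exact ⟨t.reverse, by simp [ht], by simpa, by simpa⟩
  mem_arch c := by simpa [or_comm] using h.mem_revArch c
  mem_revArch c := by simpa [or_comm] using h.mem_arch c

theorem head_notMem (h : IsAlphaBeta w α₀ β α₁ a b) : a ∉ α₁ := by
  obtain ⟨_, -, -, ha⟩ := h.head
  exact ha

theorem last_notMem (h : IsAlphaBeta w α₀ β α₁ a b) : b ∉ α₀ := by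
  obtain ⟨_, -, hb, -⟩ := h.last
  exact hb

theorem append_head_sublist_iff (h : IsAlphaBeta w α₀ β α₁ a b) :
    u ++ [a] <+ w ↔ u <+ α₀ := by
  obtain ⟨t, rfl, hat, ha₁⟩ := h.head
  simpa [h.eq] using append_singleton_sublist_append_cons_iff (u := u) (w := α₀)
    (List.not_mem_append hat ha₁)

theorem append_singleton_sublist (h : IsAlphaBeta w α₀ β α₁ a b) (hu : u <+ α₀) (c : σ) :
    u ++ [c] <+ w := by
  rw [h.eq, List.append_assoc]
  exact hu.append (List.singleton_sublist.2 (h.mem_revArch c))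

theorem congr_left (h : IsAlphaBeta w α₀ β α₁ a b) (h' : IsAlphaBeta w' α₀' β' α₁' a' b')
    (hc : Congr (k + 1) w w') : Congr k α₀ α₀' := by
  refine congr_of_sublist (fun x hx hxα => ?_) fun x hx hxα => ?_
  · exact h'.append_head_sublist_iff.1
      ((hc.sublist_iff (by simpa using hx)).1 (h.append_singleton_sublist hxα a'))
  · exact h.append_head_sublist_iff.1
      ((hc.sublist_iff (by simpa using hx)).2 (h'.append_singleton_sublist hxα a))

theorem congr_right (h : IsAlphaBeta w α₀ β α₁ a b) (h' : IsAlphaBeta w' α₀' β' α₁' a' b')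
    (hc : Congr (k + 1) w w') : Congr k α₁ α₁' :=
  congr_reverse_iff.1 (h.reverse.congr_left h'.reverse hc.reverse)

section HeadNe

variable (h : IsAlphaBeta w α₀ β α₁ a b) (h' : IsAlphaBeta w' α₀' β' α₁' a' b')
  (hc : Congr (k + 1) w w')
include h h' hc

theorem sublist_left_of_append_head_sublist (hl : u.length ≤ k) (hu : u ++ [a'] <+ w) :
    u <+ α₀ :=
  ((h.congr_left h' hc).sublist_iff hl).2
    (h'.append_head_sublist_iff.1 ((hc.sublist_iff (by simpa using hl)).1 hu))

/-- Otherwise `ba'` would be a scattered factor of `w`, hence of `w'`, which forces `b` into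
`α₀'` and so into `α₀`. -/
theorem notMem_right_of_congr (hk : 1 ≤ k) : a' ∉ α₁ := by
  intro ha'
  obtain ⟨s, rfl, hb, -⟩ := h.last
  have hsub : [b] ++ [a'] <+ w := h.eq ▸ List.Sublist.append
    (List.singleton_sublist.2 (by simp)) (List.singleton_sublist.2 ha')
  exact hb (List.singleton_sublist.1 (h.sublist_left_of_append_head_sublist h' hc hk hsub))

theorem append_head_sublist_left_of_head_ne (hne : a ≠ a') (hl : u.length < k) (hu : u <+ α₀) :
    u ++ [a] <+ α₀ := by
  refine h.sublist_left_of_append_head_sublist h' hc (by simpa using hl) ?_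
  obtain ⟨t, rfl, -, -⟩ := h.head
  have ha' : a' ∈ t ++ α₁ := by simpa [hne.symm] using h.mem_revArch a'
  have htail : [a] ++ [a'] <+ a :: (t ++ α₁) := (List.singleton_sublist.2 ha').cons_cons a
  simpa [h.eq] using hu.append htail

theorem sublist_left_of_head_ne (hne : a ≠ a') (hl : u.length ≤ k)
    (hu : ∀ c ∈ u, c = a ∨ c = a') : u <+ α₀ := by
  induction u using List.reverseRecOn with
  | nil => exact List.nil_sublist _
  | append_singleton u c ih =>
    rw [List.length_append, List.length_singleton] at hl
    obtain ⟨huu, hcu⟩ := List.forall_mem_append.1 hu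
    have hα := h.congr_left h' hc
    have hu₀ : u <+ α₀ := ih (by lia) huu
    rcases hcu c List.mem_cons_self with rfl | rfl
    · exact h.append_head_sublist_left_of_head_ne h' hc hne hl hu₀
    · exact (hα.sublist_iff (by simpa using hl)).2
        (h'.append_head_sublist_left_of_head_ne h hc.symm hne.symm hl
          ((hα.sublist_iff (by lia)).1 hu₀))

theorem isSaturated_left_of_head_ne [Fintype σ] [DecidableEq σ] (hσ : Fintype.card σ ≤ 3)
    (hk : 1 ≤ k) (hne : a ≠ a') : IsSaturated k α₀ α₁ := by
  have hmem (c : σ) (hc' : c = a ∨ c = a') : c ∈ α₀ := List.singleton_sublist.1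
    (h.sublist_left_of_head_ne h' hc hne (u := [c]) hk (by simpa using hc'))
  have hab : a ≠ b := ne_of_mem_of_not_mem (hmem a (.inl rfl)) h.last_notMem
  have ha'b : a' ≠ b := ne_of_mem_of_not_mem (hmem a' (.inr rfl)) h.last_notMem
  have hα₀ : α₀.toFinset = {a, a'} := by
    ext c
    simp only [List.mem_toFinset, Finset.mem_insert, Finset.mem_singleton]
    refine ⟨fun hcα => ?_, hmem c⟩
    have hcb : c ≠ b := ne_of_mem_of_not_mem hcα h.last_notMem
    simpa [hcb] using eq_or_eq_or_eq_of_card_le_three hσ hne hab ha'b c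
  refine ⟨by rw [hα₀, Finset.card_pair hne], ?_, fun v hl hv =>
    h.sublist_left_of_head_ne h' hc hne hl.le fun c hcv => by simpa [hα₀] using hv c hcv⟩
  simp [hα₀, Finset.inter_insert_of_notMem, h.head_notMem, h.notMem_right_of_congr h' hc hk]

theorem isSaturated_right_of_last_ne [Fintype σ] [DecidableEq σ] (hσ : Fintype.card σ ≤ 3)
    (hk : 1 ≤ k) (hne : b ≠ b') : IsSaturated k α₁ α₀ :=
  isSaturated_reverse.1 (h.reverse.isSaturated_left_of_head_ne h'.reverse hc.reverse hσ hk hne)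

end HeadNe

section Saturated

theorem sublist_of_forall_sublist_left (h : IsAlphaBeta w α₀ β α₁ a b)
    (h' : IsAlphaBeta w' α₀' β' α₁' a' b) (h₁ : Congr k α₁ α₁') (hα₁ : ∀ c ∈ α₁, c = b)
    (hα₀' : ∀ u : List σ, u.length ≤ k → b ∉ u → u <+ α₀') (hl : v.length ≤ k + 1)
    (hv : v <+ w) : v <+ w' := by
  obtain ⟨s, rfl, hb₀, hbs⟩ := h.last
  obtain ⟨s', rfl, -, -⟩ := h'.last
  have hw : w = α₀ ++ s ++ b :: α₁ := by simp [h.eq]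
  obtain ⟨p, r, rfl, hp, hr⟩ := List.sublist_append_iff.1 (hw ▸ hv)
  have hbp : b ∉ p := fun hbp => List.not_mem_append hb₀ hbs (hp.subset hbp)
  rw [List.length_append] at hl
  rcases r with _ | ⟨d, r⟩
  · rcases List.eq_nil_or_concat' p with rfl | ⟨p, c, rfl⟩
    · exact List.nil_sublist _
    · rw [List.append_nil]
      exact h'.append_singleton_sublist
        (hα₀' p (by simpa using hl) fun hb => hbp (List.mem_append_left _ hb)) c
  · obtain rfl : d = b := by
      rcases List.mem_cons.1 (hr.subset List.mem_cons_self) with hd | hd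
      exacts [hd, hα₁ d hd]
    rw [List.length_cons] at hl
    have hr' : r <+ α₁' := (h₁.sublist_iff (by lia)).1 (List.cons_sublist_cons.1 hr)
    have hd : [d] <+ s' ++ [d] := List.sublist_append_right _ _
    simpa [h'.eq] using ((hα₀' p (by lia) hbp).append hd).append hr'

variable [Fintype σ] [DecidableEq σ] (hσ : Fintype.card σ ≤ 3)
include hσ

theorem mem_left_iff_of_card_eq_two (h : IsAlphaBeta w α₀ β α₁ a b)
    (hα₀ : α₀.toFinset.card = 2) {c : σ} : c ∈ α₀ ↔ c ≠ b := by
  have hsub : α₀.toFinset ⊆ Finset.univ.erase b := fun c hc =>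
    Finset.mem_erase.2 ⟨ne_of_mem_of_not_mem (List.mem_toFinset.1 hc) h.last_notMem,
      Finset.mem_univ c⟩
  have heq : α₀.toFinset = Finset.univ.erase b := Finset.eq_of_subset_of_card_le hsub
    (by rw [Finset.card_erase_of_mem (Finset.mem_univ b), Finset.card_univ]; lia)
  simpa using Finset.ext_iff.1 heq c

theorem sublist_of_isSaturated_left (h : IsAlphaBeta w α₀ β α₁ a b)
    (h' : IsAlphaBeta w' α₀' β' α₁' a' b') (hk : 1 ≤ k) (h₀ : Congr k α₀ α₀')
    (h₁ : Congr k α₁ α₁') (hs : IsSaturated k α₀ α₁) (hl : v.length ≤ k + 1) (hv : v <+ w) :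
    v <+ w' := by
  obtain ⟨hcard, hdisj, huniv⟩ := hs
  have hα₀ (c : σ) : c ∈ α₀ ↔ c ≠ b := h.mem_left_iff_of_card_eq_two hσ hcard
  obtain rfl : b' = b := not_not.1 fun hne => h'.last_notMem ((h₀.mem_iff hk b').1 ((hα₀ b').2 hne))
  refine h.sublist_of_forall_sublist_left h' h₁ (fun c hc => ?_) (fun u hu hb => ?_) hl hv
  · by_contra hne
    have : c ∈ α₁.toFinset ∩ α₀.toFinset := by simp [hc, hα₀, hne]
    simp [hdisj] at this
  · have hne : α₀.toFinset.Nonempty := Finset.card_pos.1 (by lia)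
    refine (h₀.sublist_iff hu).1 (huniv.sublist_of_length_le hne hu fun c hc => ?_)
    exact List.mem_toFinset.2 ((hα₀ c).2 (ne_of_mem_of_not_mem hc hb))

theorem congr_of_isSaturated_left (h : IsAlphaBeta w α₀ β α₁ a b)
    (h' : IsAlphaBeta w' α₀' β' α₁' a' b') (hk : 1 ≤ k) (h₀ : Congr k α₀ α₀')
    (h₁ : Congr k α₁ α₁') (hs : IsSaturated k α₀ α₁) : Congr (k + 1) w w' :=
  congr_of_sublist (fun _ => h.sublist_of_isSaturated_left hσ h' hk h₀ h₁ hs)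
    fun _ => h'.sublist_of_isSaturated_left hσ h hk h₀.symm h₁.symm (hs.congr h₀ h₁ hk)

theorem congr_of_isSaturated_right (h : IsAlphaBeta w α₀ β α₁ a b)
    (h' : IsAlphaBeta w' α₀' β' α₁' a' b') (hk : 1 ≤ k) (h₀ : Congr k α₀ α₀')
    (h₁ : Congr k α₁ α₁') (hs : IsSaturated k α₁ α₀) : Congr (k + 1) w w' :=
  congr_reverse_iff.1 (h.reverse.congr_of_isSaturated_left hσ h'.reverse hk h₁.reverse h₀.reverse
    (isSaturated_reverse.2 hs))

end Saturated

section Core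

theorem congr_append_append (h : IsAlphaBeta w α₀ β α₁ a b) (hk : 1 ≤ k) (h₀ : Congr k α₀ α₀')
    (h₁ : Congr k α₁ α₁') : Congr (k + 1) w (α₀' ++ β ++ α₁') := by
  have hleft : Congr (k + 1) w (α₀' ++ β ++ α₁) := by
    rw [h.eq, List.append_assoc, List.append_assoc]
    exact h₀.append_right h.mem_revArch
  refine hleft.trans (h₁.append_left fun c => ?_)
  simpa [h₀.mem_iff hk] using h.mem_arch c

theorem eq_singleton (h : IsAlphaBeta w α₀ β α₁ a a) : β = [a] := by
  obtain ⟨t, rfl, -, -⟩ := h.head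
  obtain ⟨_ | ⟨c, s⟩, hs, -, has⟩ := h.last
  · simpa using hs
  · exact absurd (by simp [(List.cons_eq_cons.1 hs).1]) has

theorem exists_eq_cons_append_singleton (h : IsAlphaBeta w α₀ β α₁ a b) (hab : a ≠ b) :
    ∃ s, β = a :: s ++ [b] ∧ ∀ c ∈ s, a ≠ c ∧ b ≠ c := by
  obtain ⟨t, rfl, hat, -⟩ := h.head
  obtain ⟨_ | ⟨c, s⟩, hs, -, hbs⟩ := h.last
  · simp [hab] at hs
  · obtain ⟨rfl, rfl⟩ := List.cons_eq_cons.1 hs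
    refine ⟨s, rfl, fun c hc => ⟨?_, ?_⟩⟩
    · exact (ne_of_mem_of_not_mem (List.mem_append_left _ hc) hat).symm
    · exact (ne_of_mem_of_not_mem (List.mem_cons_of_mem _ hc) hbs).symm

theorem eq_pair (h : IsAlphaBeta w α₀ β α₁ a b) (hab : a ≠ b) (hy : ∀ y, a ≠ y → b = y) :
    β = [a, b] := by
  obtain ⟨s, rfl, hs⟩ := h.exists_eq_cons_append_singleton hab
  obtain rfl : s = [] := List.eq_nil_iff_forall_not_mem.2 fun c hc =>
    (hs c hc).2 (hy c (hs c hc).1)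
  rfl

variable [Fintype σ] (hσ : Fintype.card σ ≤ 3)
include hσ

theorem exists_eq_cons_replicate_append_singleton (h : IsAlphaBeta w α₀ β α₁ a b) (hab : a ≠ b)
    (hay : a ≠ y) (hby : b ≠ y) : ∃ m, β = a :: List.replicate m y ++ [b] := by
  obtain ⟨s, rfl, hs⟩ := h.exists_eq_cons_append_singleton hab
  refine ⟨s.length, ?_⟩
  rw [← List.eq_replicate_length.2 fun c hc => ?_]
  have := eq_or_eq_or_eq_of_card_le_three hσ hab hay hby c
  simpa [(hs c hc).1.symm, (hs c hc).2.symm] using this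

variable [DecidableEq σ] {Ω₀ Ω₁ : Finset σ}

theorem toFinset_left_subset (h : IsAlphaBeta w α₀ β α₁ a b) (hab : a ≠ b) (hay : a ≠ y)
    (hby : b ≠ y) : α₀.toFinset ⊆ {a, y} := by
  intro c hc
  have hcb : c ≠ b := ne_of_mem_of_not_mem (List.mem_toFinset.1 hc) h.last_notMem
  simpa [hcb] using eq_or_eq_or_eq_of_card_le_three hσ hab hay hby c

theorem congr_append_append_iff_congr_core (h : IsAlphaBeta w α₀ β α₁ a b)
    (h' : IsAlphaBeta w' α₀' β' α₁' a b) (hab : a ≠ b) (hay : a ≠ y) (hby : b ≠ y)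
    (hΩ₀ : Ω₀.card = 2) (hα₀ : α₀.toFinset ⊆ Ω₀) (hΩ₁ : Ω₁.card = 2) (hα₁ : α₁.toFinset ⊆ Ω₁) :
    Congr k (α₀ ++ β ++ α₁) (α₀ ++ β' ++ α₁) ↔
      Congr (k - (univIndex Ω₀ α₀ + (if y ∈ rest Ω₀ α₀ then 1 else 0)
        + univIndex Ω₁ α₁ + (if y ∈ revRest Ω₁ α₁ then 1 else 0)))
        β.tail.dropLast β'.tail.dropLast := by
  have habs₀ := absorption_append_singleton_of_card_eq_two hay
    (h.toFinset_left_subset hσ hab hay hby) hΩ₀ hα₀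
  have habs₁ := absorption_append_singleton_reverse_of_card_eq_two hby
    (by simpa using h.reverse.toFinset_left_subset hσ hab.symm hby hay) hΩ₁ hα₁
  obtain ⟨m, rfl⟩ := h.exists_eq_cons_replicate_append_singleton hσ hab hay hby
  obtain ⟨n, rfl⟩ := h'.exists_eq_cons_replicate_append_singleton hσ hab hay hby
  have hassoc (j : ℕ) : α₀ ++ (a :: List.replicate j y ++ [b]) ++ α₁ =
      α₀ ++ [a] ++ List.replicate j y ++ b :: α₁ := by simp
  rw [hassoc, hassoc, congr_append_replicate_append_iff, habs₀, habs₁, ← add_assoc]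
  simp only [List.cons_append, List.tail_cons, List.dropLast_concat]

theorem congr_iff_congr_core (h : IsAlphaBeta w α₀ β α₁ a b)
    (h' : IsAlphaBeta w' α₀' β' α₁' a b) (hk : 1 ≤ k) (h₀ : Congr k α₀ α₀')
    (h₁ : Congr k α₁ α₁') (hΩ₀ : Ω₀.card = 2) (hα₀ : α₀.toFinset ⊆ Ω₀) (hΩ₁ : Ω₁.card = 2)
    (hα₁ : α₁.toFinset ⊆ Ω₁) :
    Congr (k + 1) w w' ↔ ∀ y, a ≠ y → b ≠ y →
      Congr (k + 1 - (univIndex Ω₀ α₀ + (if y ∈ rest Ω₀ α₀ then 1 else 0)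
        + univIndex Ω₁ α₁ + (if y ∈ revRest Ω₁ α₁ then 1 else 0)))
        β.tail.dropLast β'.tail.dropLast := by
  have hw' : Congr (k + 1) w' (α₀ ++ β' ++ α₁) := h'.congr_append_append hk h₀.symm h₁.symm
  have of_eq (hβ : β = β') : Congr (k + 1) w w' := by
    rw [h.eq, hβ]
    exact hw'.symm
  rcases eq_or_ne a b with rfl | hab
  · have hβ : β = β' := h.eq_singleton.trans h'.eq_singleton.symm
    exact iff_of_true (of_eq hβ) fun y _ _ => by rw [hβ]; rfl
  refine ⟨fun hc y hay hby => ?_, fun hc => ?_⟩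
  · rw [h.eq] at hc
    exact (h.congr_append_append_iff_congr_core hσ h' hab hay hby hΩ₀ hα₀ hΩ₁ hα₁).1
      (hc.trans hw')
  · by_cases hy : ∃ y, a ≠ y ∧ b ≠ y
    · obtain ⟨y, hay, hby⟩ := hy
      rw [h.eq]
      exact ((h.congr_append_append_iff_congr_core hσ h' hab hay hby hΩ₀ hα₀ hΩ₁ hα₁).2
        (hc y hay hby)).trans hw'.symm
    · have hy : ∀ y, a ≠ y → b = y := by simpa using hy
      exact of_eq ((h.eq_pair hab hy).trans (h'.eq_pair hab hy).symm)

theorem congr_iff (h : IsAlphaBeta w α₀ β α₁ a b) (h' : IsAlphaBeta w' α₀' β' α₁' a' b')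
    (hk : 1 ≤ k) (hΩ₀ : Ω₀.card = 2) (hα₀ : α₀.toFinset ⊆ Ω₀) (hΩ₁ : Ω₁.card = 2)
    (hα₁ : α₁.toFinset ⊆ Ω₁) :
    Congr (k + 1) w w' ↔ (Congr k α₀ α₀' ∧ Congr k α₁ α₁') ∧
      ((IsSaturated k α₀ α₁ ∨ IsSaturated k α₁ α₀) ∨ b = b' ∧ a = a' ∧ ∀ y, b ≠ y → a ≠ y →
        Congr (k + 1 - (univIndex Ω₀ α₀ + (if y ∈ rest Ω₀ α₀ then 1 else 0)
          + univIndex Ω₁ α₁ + (if y ∈ revRest Ω₁ α₁ then 1 else 0)))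
          β.tail.dropLast β'.tail.dropLast) := by
  constructor
  · intro hc
    have h₀ := h.congr_left h' hc
    have h₁ := h.congr_right h' hc
    refine ⟨⟨h₀, h₁⟩, ?_⟩
    by_cases ha : a = a'
    · by_cases hb : b = b'
      · subst ha hb
        exact .inr ⟨rfl, rfl, fun y hby hay =>
          (h.congr_iff_congr_core hσ h' hk h₀ h₁ hΩ₀ hα₀ hΩ₁ hα₁).1 hc y hay hby⟩
      · exact .inl (.inr (h.isSaturated_right_of_last_ne h' hc hσ hk hb))
    · exact .inl (.inl (h.isSaturated_left_of_head_ne h' hc hσ hk ha))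
  · rintro ⟨⟨h₀, h₁⟩, (hs | hs) | ⟨rfl, rfl, hcore⟩⟩
    · exact h.congr_of_isSaturated_left hσ h' hk h₀ h₁ hs
    · exact h.congr_of_isSaturated_right hσ h' hk h₀ h₁ hs
    · exact (h.congr_iff_congr_core hσ h' hk h₀ h₁ hΩ₀ hα₀ hΩ₁ hα₁).2
        fun y hay hby => hcore y hby hay

end Core

end IsAlphaBeta

theorem isSaturated_iff [DecidableEq σ] {Ω : Finset σ} (hΩ : Ω.card = 2)
    (hu : u.toFinset ⊆ Ω) : IsSaturated k u v ↔
      u.toFinset.card = 2 ∧ v.toFinset ∩ u.toFinset = ∅ ∧ k ≤ univIndex Ω u := by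
  refine and_congr_right fun hcard => and_congr_right fun _ => ?_
  rw [Finset.eq_of_subset_of_card_le hu (hΩ.trans hcard.symm).le,
    le_univIndex_iff (Finset.card_pos.1 (by lia))]

end AlphaBeta

section Existence

theorem exists_eq_append_of_append_cons_eq_append {u v s t : List σ} {a : σ}
    (h : u ++ a :: v = s ++ t) (hs : ¬ u ++ [a] ⊆ s) : ∃ x, u = s ++ x ∧ x ++ a :: v = t := by
  rcases List.append_eq_append_iff.1 h with ⟨_ | ⟨c, x⟩, rfl, hx⟩ | ⟨x, rfl, rfl⟩
  · exact ⟨[], by simp, by simpa using hx⟩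
  · obtain ⟨rfl, -⟩ := List.cons_eq_cons.1 hx
    exact absurd (by simp) hs
  · exact ⟨x, rfl, rfl⟩

theorem exists_arches_eq_singleton [DecidableEq σ] {Ω : Finset σ} {w : List σ} (hΩ : Ω.Nonempty)
    (hw : univIndex Ω w = 1) :
    ∃ s b, arches Ω w = [s ++ [b]] ∧ s ++ b :: rest Ω w = w ∧ b ∉ s ∧
      Ω ⊆ (s ++ [b]).toFinset := by
  rw [univIndex_eq_length_arches hΩ] at hw
  obtain ⟨A, hA⟩ := List.length_eq_one_iff.1 hw
  obtain ⟨heq, harch, -⟩ := arches_spec Ω hΩ w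
  rw [hA] at heq harch
  obtain ⟨hsub, hlast⟩ := harch A List.mem_cons_self
  rcases List.eq_nil_or_concat' A with rfl | ⟨s, b, rfl⟩
  · exact absurd hsub hlast
  rw [List.dropLast_concat] at hlast
  exact ⟨s, b, hA, by simpa using heq,
    (mem_and_notMem_of_subset_toFinset_append_singleton hsub hlast).2, hsub⟩

variable [Fintype σ] [DecidableEq σ]

theorem exists_isAlphaBeta [Nonempty σ] {w : List σ} (hw : univIndex Finset.univ w = 1) :
    ∃ a b, IsAlphaBeta w (alpha w 0) (beta w 1) (alpha w 1) a b ∧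
      modus Finset.univ w = [b] ∧ revModus Finset.univ w = [a] := by
  have hne : (Finset.univ : Finset σ).Nonempty := Finset.univ_nonempty
  obtain ⟨s, b, hs, hsw, hbs, hsuniv⟩ := exists_arches_eq_singleton hne hw
  obtain ⟨t, a, ht, htw, hat, htuniv⟩ :=
    exists_arches_eq_singleton hne ((univIndex_reverse _ w).trans hw)
  have hmem (c : σ) : c ∈ s ++ [b] := List.mem_toFinset.1 (hsuniv (Finset.mem_univ c))
  have hmem' (c : σ) : c ∈ t ++ [a] := List.mem_toFinset.1 (htuniv (Finset.mem_univ c))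
  have hα₀ : alpha w 0 = (rest Finset.univ w.reverse).reverse := by simp only [alpha, revRest]
  have hwα : s ++ b :: rest Finset.univ w = alpha w 0 ++ a :: t.reverse := by
    rw [hsw, hα₀]
    simpa using (congrArg List.reverse htw).symm
  have hnot : ¬ s ++ [b] ⊆ alpha w 0 := fun hsub => not_subset_rest hne w.reverse fun c _ =>
    List.mem_toFinset.2 (List.mem_reverse.1 (hα₀ ▸ hsub (hmem c)))
  obtain ⟨x, rfl, hx⟩ := exists_eq_append_of_append_cons_eq_append hwα hnot
  have hβ : beta w 1 = x ++ [b] := by simp [beta, hs]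
  have hα₁ : alpha w 1 = rest Finset.univ w := by
    simp [alpha, revArches, ht, hβ, ← hx]
  have hβα : beta w 1 ++ alpha w 1 = a :: t.reverse := by simp [hβ, hα₁, hx]
  refine ⟨a, b, ⟨?_, ?_, ?_, ?_, ?_⟩, by simp [modus, hs], by simp [revModus, modus, ht]⟩
  · rw [List.append_assoc, hβα, ← hwα, hsw]
  · rcases List.append_eq_cons_iff.1 hβα with ⟨hnil, -⟩ | ⟨v, hv, htv⟩
    · simp [hβ] at hnil
    · have hav : a ∉ v ++ alpha w 1 := htv ▸ List.mem_reverse.not.2 hat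
      exact ⟨v, hv, by simpa using hav⟩
  · exact ⟨x, hβ, by simpa using hbs⟩
  · simpa [hβ] using hmem
  · simpa [hβα, or_comm] using hmem'

end Existence

end Simon

open Simon in
theorem mainTheorem7_general {σ : Type*} [Fintype σ] [DecidableEq σ] (hσ : Fintype.card σ ≤ 3)
    (k : ℕ) (hk : 2 ≤ k) (w w' : List σ)
    (hw : univIndex Finset.univ w = 1) (hw' : univIndex Finset.univ w' = 1) (Ω : ℕ → Finset σ)
    (hΩ : ∀ i ≤ 1, (Ω i).card = 2 ∧ (alpha w i).toFinset ⊆ Ω i) :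
    Congr k w w' ↔
      (∀ i ≤ 1, Congr (k - 1) (alpha w i) (alpha w' i)) ∧
      ((∃ i ≤ 1, (alpha w i).toFinset.card = 2 ∧
          (alpha w (1 - i)).toFinset ∩ (alpha w i).toFinset = ∅ ∧
          k - 1 ≤ univIndex (Ω i) (alpha w i)) ∨
       (modus Finset.univ w = modus Finset.univ w' ∧
        revModus Finset.univ w = revModus Finset.univ w' ∧
        ∀ y : σ, y ∉ modus Finset.univ w → y ∉ revModus Finset.univ w →
          Congr
            (k - (univIndex (Ω 0) (alpha w 0) + (if y ∈ rest (Ω 0) (alpha w 0) then 1 else 0)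
              + univIndex (Ω 1) (alpha w 1) + (if y ∈ revRest (Ω 1) (alpha w 1) then 1 else 0)))
            (core w 1) (core w' 1))) := by
  obtain ⟨k, rfl⟩ := Nat.exists_eq_add_of_le' (one_le_two.trans hk)
  obtain ⟨hΩ₀, hα₀⟩ := hΩ 0 zero_le_one
  obtain ⟨hΩ₁, hα₁⟩ := hΩ 1 le_rfl
  have : Nonempty σ := (Finset.card_pos.1 (hΩ₀ ▸ two_pos)).to_type
  obtain ⟨a, b, h, hb, ha⟩ := exists_isAlphaBeta hw
  obtain ⟨a', b', h', hb', ha'⟩ := exists_isAlphaBeta hw'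
  rw [h.congr_iff hσ h' (Nat.le_of_succ_le_succ hk) hΩ₀ hα₀ hΩ₁ hα₁,
    isSaturated_iff hΩ₀ hα₀, isSaturated_iff hΩ₁ hα₁]
  simp [Nat.le_one_iff_eq_zero_or_eq_one, or_and_right, exists_or, forall_and, or_imp, hb, hb', ha,
    ha', core, eq_comm]

theorem mainTheorem7 {σ : Type*} [Fintype σ] [DecidableEq σ] (hσ : Fintype.card σ = 3)
    (k : ℕ) (hk : 2 ≤ k) (w w' : List σ)
    (hw : Simon.univIndex Finset.univ w = 1) (hw' : Simon.univIndex Finset.univ w' = 1)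
    -- `Ω i` is any binary alphabet containing the letters of `α_i`
    (Ω : ℕ → Finset σ)
    (hΩ : ∀ i ≤ 1, (Ω i).card = 2 ∧ (Simon.alpha w i).toFinset ⊆ Ω i) :
    Simon.Congr k w w' ↔
      (∀ i ≤ 1, Simon.Congr (k - 1) (Simon.alpha w i) (Simon.alpha w' i)) ∧
      ((∃ i ≤ 1, (Simon.alpha w i).toFinset.card = 2 ∧
          (Simon.alpha w (1 - i)).toFinset ∩ (Simon.alpha w i).toFinset = ∅ ∧
          k - 1 ≤ Simon.univIndex (Ω i) (Simon.alpha w i)) ∨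
       (Simon.modus Finset.univ w = Simon.modus Finset.univ w' ∧
        Simon.revModus Finset.univ w = Simon.revModus Finset.univ w' ∧
        -- `y` is the letter of the cores: it differs from the modus and the reverse modus
        ∀ y : σ, y ∉ Simon.modus Finset.univ w → y ∉ Simon.revModus Finset.univ w →
          Simon.Congr
            (k - (Simon.univIndex (Ω 0) (Simon.alpha w 0)
              + (if y ∈ Simon.rest (Ω 0) (Simon.alpha w 0) then 1 else 0)
              + Simon.univIndex (Ω 1) (Simon.alpha w 1)
              + (if y ∈ Simon.revRest (Ω 1) (Simon.alpha w 1) then 1 else 0)))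
            (Simon.core w 1) (Simon.core w' 1))) :=
  mainTheorem7_general hσ.le k hk w w' hw hw' Ω hΩ
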